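/- Setting. Let $X$, $\partial X$, $\partial Y$ be (real or complex) Banach spaces with a continuous embedding $\partial Y\hookrightarrow\partial X$. Let $A:D(A)\subset X\to X$ be linear, let $L:D(A)\to\partial Y$ be linear and surjective, and assume that $\binom{A}{L}$ is closed as an operator from $X$ to $X\times\partial Y$ and that $A_0:=A|_{\ker L}$ has nonempty resolvent set. Let $D:D(D)\subset\partial X\to\partial X$, $B:D(B)\subset\partial X\to X$ and $C:D(C)\subset X\to\partial X$ be linear with $D(D)\subset D(B)$ and $D(A)\subset D(C)$. On $X\times\partial X$ consider the operator matrix with coupled domain $$\mathbf A=\begin{pmatrix}A&B\\ C&D\end{pmatrix},\qquad D(\mathbf A)=\left\{\begin{pmatrix}u\\x\end{pmatrix}\in D(A)\times(D(D)\cap\partial Y):\ Lu=x\right\}.$$ Assume that $A_0$ is invertible (that is, $0\in\rho(A_0)$), and let $D_0:\partial Y\to D(A)$ be the Dirichlet operator: for $y\in\partial Y$, $u=D_0y$ is the unique element of $D(A)$ with $Au=0$ and $Lu=y$. Assume that $D_0$ has an extension $\overline{D}_0\in\mathcal L(\partial X,X)$ and that $B-\overline{D}_0D$ is bounded from $\partial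 X$ to $X$ on $D(D)\cap\partial Y$. Proposition. Let $M_1,M_2\ge1$ and $\varepsilon_1,\varepsilon_2<0$. Suppose that $A_0-\overline{D}_0C$, with domain $D(A_0)$, generates a $C_0$-semigroup on $X$, that $D+CD_0$, with domain $D(D)\cap\partial Y$, generates a $C_0$-semigroup on $\partial X$, and that $$\|e^{t(A_0-\overline{D}_0C)}\|\le M_1e^{\varepsilon_1t},\qquad \|e^{t(D+CD_0)}\|\le M_2e^{\varepsilon_2t},\qquad t\ge0.$$ If $C$ is bounded from $X$ to $\partial X$ (that is, $\|Cu\|\le c\|u\|$ for some $c$ and all $u\in D(C)$) and $$\|C\|\,\bigl\|B-\overline{D}_0(D+CD_0)\bigr\|<\frac{\varepsilon_1\varepsilon_2}{M_1M_2},$$ where the norms are the operator norms on the domains $D(C)$ and $D(D)\cap\partial Y$, then $\mathbf A$ generates a $C_0$-semigroup on $X\times\partial X$, and this semigroup is uniformly exponentially stable: there are $M\ge 0$ and $\omega>0$ with $\|e^{t\mathbf A}\|\le Me^{-\omega t}$ for all $t\ge0$. -/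

import Mathlib

open Filter Topology

/-- An operator `f : D(f) ⊆ E → F` is bounded if `‖f x‖ ≤ c ‖x‖` on its domain, for some `c`. -/
def LinearPMap.IsBoundedOp {𝕜 E F : Type*} [RCLike 𝕜]
    [NormedAddCommGroup E] [NormedSpace 𝕜 E] [NormedAddCommGroup F] [NormedSpace 𝕜 F]
    (f : E →ₗ.[𝕜] F) : Prop :=
  ∃ c : ℝ, ∀ x : f.domain, ‖f x‖ ≤ c * ‖(x : E)‖

/-- The operator norm of a bounded operator `f : D(f) ⊆ E → F`: its least bound on its domain.
If the domain is dense, this is the norm of the continuous extension of `f` to `E`. -/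
noncomputable def LinearPMap.opNormOn {𝕜 E F : Type*} [RCLike 𝕜]
    [NormedAddCommGroup E] [NormedSpace 𝕜 E] [NormedAddCommGroup F] [NormedSpace 𝕜 F]
    (f : E →ₗ.[𝕜] F) : ℝ :=
  sInf {c : ℝ | 0 ≤ c ∧ ∀ x : f.domain, ‖f x‖ ≤ c * ‖(x : E)‖}

/-- The resolvent set of `f : D(f) ⊆ E → E`: those `μ` for which `μ - f : D(f) → E` is
bijective with bounded inverse `R`. -/
def LinearPMap.resolventSetOp {𝕜 E : Type*} [RCLike 𝕜]
    [NormedAddCommGroup E] [NormedSpace 𝕜 E] (f : E →ₗ.[𝕜] E) : Set 𝕜 :=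
  {μ | ∃ R : E →L[𝕜] E,
    (∀ x : E, ∃ h : R x ∈ f.domain, μ • R x - f ⟨R x, h⟩ = x) ∧
    ∀ x : f.domain, R (μ • (x : E) - f x) = x}

/-- `(T t)_{t ≥ 0}` is a `C₀`-semigroup of bounded operators on `E`; the values at `t < 0` are
irrelevant. -/
structure IsC0Semigroup {𝕜 E : Type*} [RCLike 𝕜]
    [NormedAddCommGroup E] [NormedSpace 𝕜 E] (T : ℝ → E →L[𝕜] E) : Prop where
  map_zero : T 0 = ContinuousLinearMap.id 𝕜 E
  map_add : ∀ s t : ℝ, 0 ≤ s → 0 ≤ t → T (s + t) = (T s).comp (T t)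
  continuousOn : ∀ x : E, ContinuousOn (fun t => T t x) (Set.Ici 0)

/-- The operator `f` is the generator of the `C₀`-semigroup `T`: `x ∈ D(f)` and `f x = y` if
and only if `(T t x - x) / t → y` as `t ↓ 0`. -/
structure Generates {𝕜 E : Type*} [RCLike 𝕜]
    [NormedAddCommGroup E] [NormedSpace 𝕜 E] (f : E →ₗ.[𝕜] E) (T : ℝ → E →L[𝕜] E) : Prop where
  isC0Semigroup : IsC0Semigroup T
  mem_graph_iff : ∀ x y : E, (x, y) ∈ f.graph ↔
    Tendsto (fun t : ℝ => ((t⁻¹ : ℝ) : 𝕜) • (T t x - x)) (𝓝[>] 0) (𝓝 y)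

/-- Uniform exponential stability of `(T t)_{t ≥ 0}`. -/
def UniformlyExponentiallyStable {𝕜 E : Type*} [RCLike 𝕜]
    [NormedAddCommGroup E] [NormedSpace 𝕜 E] (T : ℝ → E →L[𝕜] E) : Prop :=
  ∃ M ω : ℝ, 0 < ω ∧ ∀ t : ℝ, 0 ≤ t → ‖T t‖ ≤ M * Real.exp (-ω * t)

/-- The abstract setting for an operator matrix with coupled domain. Here `X` is the state space,
`dX` the boundary space, `dY` a Banach space embedded continuously in `dX` by `ι`, and `L` is
the boundary operator. -/
structure BoundarySetting (𝕜 X dX dY : Type*) [RCLike 𝕜]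
    [NormedAddCommGroup X] [NormedSpace 𝕜 X]
    [NormedAddCommGroup dX] [NormedSpace 𝕜 dX]
    [NormedAddCommGroup dY] [NormedSpace 𝕜 dY] where
  ι : dY →L[𝕜] dX
  ι_injective : Function.Injective ι
  A : X →ₗ.[𝕜] X
  L : A.domain →ₗ[𝕜] dY
  L_surjective : Function.Surjective L
  D : dX →ₗ.[𝕜] dX
  B : dX →ₗ.[𝕜] X
  C : X →ₗ.[𝕜] dX
  D_domain_le : D.domain ≤ B.domain
  A_domain_le : A.domain ≤ C.domain
  /-- the restriction of `A` to `ker L` has nonempty resolvent set -/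
  resolvent_nonempty :
    (A.domRestrict ((LinearMap.ker L).map A.domain.subtype)).resolventSetOp.Nonempty
  /-- `u ↦ (A u, L u)` is closed as an operator from `X` to `X × dY` -/
  closed_AL : IsClosed {p : X × X × dY | ∃ u : A.domain, p = ((u : X), A u, L u)}

namespace BoundarySetting

variable {𝕜 X dX dY : Type*} [RCLike 𝕜]
  [NormedAddCommGroup X] [NormedSpace 𝕜 X]
  [NormedAddCommGroup dX] [NormedSpace 𝕜 dX]
  [NormedAddCommGroup dY] [NormedSpace 𝕜 dY]
  (S : BoundarySetting 𝕜 X dX dY)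

/-- `A₀`, the restriction of `A` to `ker L`. -/
def A₀ : X →ₗ.[𝕜] X :=
  S.A.domRestrict ((LinearMap.ker S.L).map S.A.domain.subtype)

/-- The eigenspace `{u ∈ D(A) : A u = μ u}`. -/
def eigenspace (μ : 𝕜) : Submodule 𝕜 S.A.domain :=
  LinearMap.ker (S.A.toFun - μ • S.A.domain.subtype)

/-- For `μ ∈ ρ(A₀)` the problem `A u = μ u`, `L u = y` is uniquely solvable. -/
theorem bijective_L_eigenspace {μ : 𝕜} (hμ : μ ∈ S.A₀.resolventSetOp) :
    Function.Bijective (S.L.domRestrict (S.eigenspace μ)) := by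
  obtain ⟨R, hR₁, hR₂⟩ := hμ
  have hmem : ∀ u : S.A.domain, u ∈ S.eigenspace μ ↔ S.A u = μ • (u : X) := by
    intro u
    change S.A u - μ • (u : X) = 0 ↔ _
    exact sub_eq_zero
  have hdom : ∀ u : S.A.domain, S.L u = 0 → (u : X) ∈ S.A₀.domain := fun u hu =>
    ⟨⟨u, hu, rfl⟩, u.2⟩
  refine ⟨?_, fun y => ?_⟩
  · rw [injective_iff_map_eq_zero]
    rintro ⟨u, hu⟩ hLu
    have h := hR₂ ⟨u, hdom u hLu⟩
    have h' : S.A₀ ⟨u, hdom u hLu⟩ = S.A u := rfl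
    rw [h', (hmem u).1 hu, sub_self, map_zero] at h
    exact Subtype.ext (Subtype.ext h.symm)
  · obtain ⟨w, rfl⟩ := S.L_surjective y
    obtain ⟨hv, hv'⟩ := hR₁ (μ • (w : X) - S.A w)
    obtain ⟨⟨v, hvL, hvR⟩, -⟩ := id hv
    have hv'' : μ • (v : X) - S.A v = μ • (w : X) - S.A w := by
      have hA : S.A₀ ⟨_, hv⟩ = S.A v := LinearPMap.domRestrict_apply hvR.symm
      rw [hA] at hv'
      rw [← hv', ← hvR]
      rfl
    refine ⟨⟨w - v, (hmem _).2 ?_⟩, ?_⟩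
    · rw [LinearPMap.map_sub, Submodule.coe_sub, smul_sub]
      linear_combination (norm := module) hv''
    · change S.L (w - v) = _
      rw [map_sub, LinearMap.mem_ker.1 hvL, sub_zero]

/-- The Dirichlet operator `D_μ`: `D_μ y` is the unique `u ∈ D(A)` with `A u = μ u`, `L u = y`. -/
noncomputable def dirichlet {μ : 𝕜} (hμ : μ ∈ S.A₀.resolventSetOp) : dY →ₗ[𝕜] S.A.domain :=
  (S.eigenspace μ).subtype ∘ₗ
    (LinearEquiv.ofBijective _ (S.bijective_L_eigenspace hμ)).symm.toLinearMap

/-- The operator `C D_μ`, as an operator in `dX` with domain `dY`. -/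
noncomputable def CDirichlet {μ : 𝕜} (hμ : μ ∈ S.A₀.resolventSetOp) : dX →ₗ.[𝕜] dX where
  domain := LinearMap.range S.ι.toLinearMap
  toFun := S.C.toFun ∘ₗ Submodule.inclusion S.A_domain_le ∘ₗ S.dirichlet hμ ∘ₗ
    (LinearEquiv.ofInjective S.ι.toLinearMap S.ι_injective).symm.toLinearMap

/-- `D + C D_μ`, with domain `D(D) ∩ dY`. -/
noncomputable def feedback {μ : 𝕜} (hμ : μ ∈ S.A₀.resolventSetOp) : dX →ₗ.[𝕜] dX :=
  S.D + S.CDirichlet hμ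

/-- The coupled domain `{(u, x) ∈ D(A) × (D(D) ∩ dY) : L u = x}`. -/
def coupledDomain : Submodule 𝕜 (X × dX) where
  carrier := {p | ∃ h : p.1 ∈ S.A.domain, p.2 ∈ S.D.domain ∧ S.ι (S.L ⟨p.1, h⟩) = p.2}
  zero_mem' := ⟨S.A.domain.zero_mem, S.D.domain.zero_mem, by
    have : (⟨(0 : X × dX).1, S.A.domain.zero_mem⟩ : S.A.domain) = 0 := rfl
    rw [this, map_zero, map_zero]; rfl⟩
  add_mem' := by
    rintro p q ⟨hp, hp', hpe⟩ ⟨hq, hq', hqe⟩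
    refine ⟨S.A.domain.add_mem hp hq, S.D.domain.add_mem hp' hq', ?_⟩
    have : (⟨(p + q).1, S.A.domain.add_mem hp hq⟩ : S.A.domain) = ⟨p.1, hp⟩ + ⟨q.1, hq⟩ := rfl
    rw [this, map_add, map_add, hpe, hqe]; rfl
  smul_mem' := by
    rintro c p ⟨hp, hp', hpe⟩
    refine ⟨S.A.domain.smul_mem c hp, S.D.domain.smul_mem c hp', ?_⟩
    have : (⟨(c • p).1, S.A.domain.smul_mem c hp⟩ : S.A.domain) = c • ⟨p.1, hp⟩ := rfl
    rw [this, map_smul, map_smul, hpe]; rfl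

/-- The operator matrix `(u, x) ↦ (A u + B x, C u + D x)` on `X × dX` with coupled domain. -/
def matrix : (X × dX) →ₗ.[𝕜] (X × dX) where
  domain := S.coupledDomain
  toFun :=
    let u : S.coupledDomain →ₗ[𝕜] S.A.domain :=
      (LinearMap.fst 𝕜 X dX ∘ₗ S.coupledDomain.subtype).codRestrict S.A.domain
        (fun p => p.2.1)
    let x : S.coupledDomain →ₗ[𝕜] S.D.domain :=
      (LinearMap.snd 𝕜 X dX ∘ₗ S.coupledDomain.subtype).codRestrict S.D.domain
        (fun p => p.2.2.1)
    LinearMap.prod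
      (S.A.toFun ∘ₗ u + S.B.toFun ∘ₗ Submodule.inclusion S.D_domain_le ∘ₗ x)
      (S.C.toFun ∘ₗ Submodule.inclusion S.A_domain_le ∘ₗ u + S.D.toFun ∘ₗ x)

end BoundarySetting

/-! On the coupled domain x = L u, so w = u - D₀ x lies in ker L. The shear (u, x) ↦ (u - Dbar x, x)
is bounded and invertible on the whole product, and conjugating the matrix by it
(`mem_graph_matrix_iff_shear`) gives the diagonal operator with entries A₀ - Dbar C and D + C D₀
plus the bounded off-diagonal part (w, x) ↦ (P x, C w), where P extends B - Dbar (D + C D₀).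
Coupling of the domain has disappeared.

What remains is a small-gain argument. Scaling the second component by r > 0 replaces P, C by r⁻¹ P,
r C; the hypothesis on the product allows r with M₁ ‖r⁻¹ P‖ < -ε₁ and M₂ ‖r C‖ < -ε₂
(`exists_pos_scaling`). In the sup norm of the product the Volterra operator of Duhamel's formula is
then a strict contraction on bounded continuous functions, and stays one after both semigroups are
multiplied by exp (δ t) for small δ > 0. A Neumann series yields a bounded perturbed semigroup
(`IsC0Semigroup.exists_perturbation`); removing the factor exp (δ t) gives decay. Since a generator
determines its semigroup, the decay passes to every semigroup generated by the matrix. -/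

open scoped BoundedContinuousFunction

/-! ### Continuity and algebra of semigroup orbits -/

namespace IsC0Semigroup

variable {𝕜 Z : Type*} [RCLike 𝕜] [NormedAddCommGroup Z] [NormedSpace 𝕜 Z]
  {T : ℝ → Z →L[𝕜] Z}

/-- Values at negative times are arbitrary, so `max t 0` freezes the orbit there and makes it
continuous on all of ℝ. -/
theorem continuous_max (hT : IsC0Semigroup T) (x : Z) : Continuous fun t : ℝ => T (max t 0) x :=
  (hT.continuousOn x).comp_continuous (by fun_prop) fun t => le_max_right t 0

/-- The bound `M` is a Lipschitz constant in the vector, uniform in time; with strong continuity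
this gives joint continuity. -/
theorem continuous_uncurry (hT : IsC0Semigroup T) {M : ℝ} (hM : ∀ t, 0 ≤ t → ‖T t‖ ≤ M) :
    Continuous fun p : ℝ × Z => T (max p.1 0) p.2 := by
  have hM0 : 0 ≤ M := (norm_nonneg _).trans (hM 0 le_rfl)
  refine continuous_prod_of_continuous_lipschitzWith' _ M.toNNReal (fun t => ?_)
    fun x => hT.continuous_max x
  refine LipschitzWith.of_dist_le_mul fun x y => ?_
  rw [dist_eq_norm, dist_eq_norm, ← map_sub, Real.coe_toNNReal _ hM0]
  exact (T _).le_of_opNorm_le (hM _ (le_max_right t 0)) _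

theorem apply_add (hT : IsC0Semigroup T) {s t : ℝ} (hs : 0 ≤ s) (ht : 0 ≤ t) (x : Z) : T (s + t) x = T s (T t x) := by
  rw [hT.map_add s t hs ht]; rfl

theorem apply_zero (hT : IsC0Semigroup T) (x : Z) : T 0 x = x := by rw [hT.map_zero]; rfl

end IsC0Semigroup

/-! ### Generators: density of the domain and uniqueness of the semigroup -/

section Semigroup

variable {𝕜 Z : Type*} [RCLike 𝕜] [NormedAddCommGroup Z] [NormedSpace 𝕜 Z] [NormedSpace ℝ Z]

/-- `y` is the right derivative at `0` of the orbit `t ↦ T t x`. -/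
def HasGenValue (T : ℝ → Z →L[𝕜] Z) (x y : Z) : Prop :=
  Tendsto (fun t : ℝ => t⁻¹ • (T t x - x)) (𝓝[>] 0) (𝓝 y)

/-- The integrand may depend on the endpoint `h`, as a Duhamel kernel does; continuity at (0, 0)
controls it uniformly for 0 < s ≤ h. -/
theorem tendsto_average_diagonal [CompleteSpace Z] {F : ℝ → ℝ → Z} (hF : Continuous (Function.uncurry F)) :
    Tendsto (fun h : ℝ => h⁻¹ • ∫ s in (0 : ℝ)..h, F h s) (𝓝[>] 0) (𝓝 (F 0 0)) := by
  rw [Metric.tendsto_nhdsWithin_nhds]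
  intro ε hε
  obtain ⟨δ, hδ, H⟩ := Metric.continuous_iff.1 hF (0, 0) (ε / 2) (half_pos hε)
  refine ⟨δ, hδ, fun {h} hh hd => ?_⟩
  have hh : 0 < h := hh
  rw [Real.dist_eq, sub_zero, abs_of_pos hh] at hd
  have hint : ∀ a b : ℝ, IntervalIntegrable (fun s => F h s) MeasureTheory.volume a b :=
    fun a b => (hF.comp (by fun_prop : Continuous fun s : ℝ => (h, s))).intervalIntegrable a b
  have key : h⁻¹ • (∫ s in (0 : ℝ)..h, F h s) - F 0 0
      = h⁻¹ • ∫ s in (0 : ℝ)..h, (F h s - F 0 0) := by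
    rw [intervalIntegral.integral_sub (hint _ _) (by simp), intervalIntegral.integral_const,
      sub_zero, smul_sub, smul_smul, inv_mul_cancel₀ hh.ne', one_smul]
  rw [dist_eq_norm, key, norm_smul, norm_inv, Real.norm_eq_abs, abs_of_pos hh]
  have hb : ‖∫ s in (0 : ℝ)..h, (F h s - F 0 0)‖ ≤ ε / 2 * |h - 0| := by
    refine intervalIntegral.norm_integral_le_of_norm_le_const fun s hs => ?_
    rw [Set.uIoc_of_le hh.le] at hs
    have := H (h, s) (by
      rw [Prod.dist_eq, max_lt_iff]
      simp only [Real.dist_eq, sub_zero, abs_of_pos hh, abs_of_pos hs.1]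
      exact ⟨hd, hs.2.trans_lt hd⟩)
    rw [dist_eq_norm] at this
    exact this.le
  rw [sub_zero, abs_of_pos hh] at hb
  calc h⁻¹ * ‖∫ s in (0 : ℝ)..h, (F h s - F 0 0)‖ ≤ h⁻¹ * (ε / 2 * h) := by gcongr
    _ = ε / 2 := by field_simp
    _ < ε := half_lt_self hε




theorem HasGenValue.apply [IsScalarTower ℝ 𝕜 Z] {T : ℝ → Z →L[𝕜] Z} (hT : IsC0Semigroup T)
    {x y : Z} (h : HasGenValue T x y) {s : ℝ} (hs : 0 ≤ s) : HasGenValue T (T s x) (T s y) := by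
  refine (((T s).continuous.tendsto y).comp h).congr' ?_
  filter_upwards [self_mem_nhdsWithin] with t ht
  have ht : 0 < t := ht
  change T s (t⁻¹ • (T t x - x)) = _
  rw [(T s).map_smul_of_tower, map_sub, ← hT.apply_add hs ht.le, ← hT.apply_add ht.le hs, add_comm]

/-- Translating the integral by `h` cancels the overlap, so the difference quotient is an average of
the orbit just after `t` minus one just after 0. -/
theorem IsC0Semigroup.hasGenValue_integral [IsScalarTower ℝ 𝕜 Z] [CompleteSpace Z]
    {T : ℝ → Z →L[𝕜] Z} (hT : IsC0Semigroup T) (x : Z) {t : ℝ} (ht : 0 ≤ t) :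
    HasGenValue T (∫ s in (0 : ℝ)..t, T (max s 0) x) (T t x - x) := by
  have hc := hT.continuous_max x
  have hi : ∀ a b : ℝ, IntervalIntegrable (fun s => T (max s 0) x) MeasureTheory.volume a b :=
    fun a b => hc.intervalIntegrable a b
  have h1 := tendsto_average_diagonal (F := fun _ s => T (max (s + t) 0) x)
    (hc.comp (by fun_prop : Continuous fun p : ℝ × ℝ => p.2 + t))
  have h2 := tendsto_average_diagonal (F := fun _ s => T (max s 0) x) (hc.comp continuous_snd)
  simp only [zero_add, max_eq_left ht, max_self, hT.apply_zero] at h1 h2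
  refine (h1.sub h2).congr' ?_
  filter_upwards [self_mem_nhdsWithin] with h hh
  have hh : 0 < h := hh
  rw [← smul_sub]
  congr 1
  rw [← ContinuousLinearMap.intervalIntegral_comp_comm _ (hi 0 t)]
  have e1 : ∫ s in (0 : ℝ)..t, T h (T (max s 0) x) = ∫ s in (0 : ℝ)..t, T (max (s + h) 0) x := by
    refine intervalIntegral.integral_congr fun s hs => ?_
    rw [Set.uIcc_of_le ht] at hs
    rw [max_eq_left hs.1, max_eq_left (add_nonneg hs.1 hh.le), add_comm,
      hT.apply_add hh.le hs.1]
  rw [e1, intervalIntegral.integral_comp_add_right (fun s => T (max s 0) x),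
    intervalIntegral.integral_comp_add_right (fun s => T (max s 0) x), zero_add, zero_add,
    ← intervalIntegral.integral_interval_sub_left (hi 0 (t + h)) (hi 0 h),
    ← intervalIntegral.integral_interval_sub_left (hi 0 (h + t)) (hi 0 t), add_comm h t]
  abel

/-- Averages of the orbit over [0, t] lie in the generator domain and tend to `x` as t ↓ 0. -/
theorem IsC0Semigroup.dense_hasGenValue [IsScalarTower ℝ 𝕜 Z] [CompleteSpace Z]
    {T : ℝ → Z →L[𝕜] Z} (hT : IsC0Semigroup T) : Dense {x | ∃ y, HasGenValue T x y} := by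
  intro x
  have h := tendsto_average_diagonal (F := fun _ s => T (max s 0) x)
    ((hT.continuous_max x).comp continuous_snd)
  simp only [max_self, hT.apply_zero] at h
  refine mem_closure_of_tendsto h ?_
  filter_upwards [self_mem_nhdsWithin] with t ht
  refine ⟨t⁻¹ • (T t x - x), ?_⟩
  refine ((hT.hasGenValue_integral x (le_of_lt ht)).const_smul t⁻¹).congr fun s => ?_
  rw [(T s).map_smul_of_tower, ← smul_sub, smul_comm]

/-- A `C₀`-semigroup is determined by its generator. -/
theorem IsC0Semigroup.eq_of_hasGenValue_iff [IsScalarTower ℝ 𝕜 Z] [CompleteSpace Z]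
    {V W : ℝ → Z →L[𝕜] Z} (hV : IsC0Semigroup V) {M : ℝ} (hM : ∀ t, 0 ≤ t → ‖V t‖ ≤ M)
    (hW : IsC0Semigroup W) (h : ∀ x y, HasGenValue V x y ↔ HasGenValue W x y) {t : ℝ}
    (ht : 0 ≤ t) : V t = W t := by
  refine ContinuousLinearMap.coeFn_injective
    ((V t).continuous.ext_on hW.dense_hasGenValue (W t).continuous ?_)
  rintro x ⟨y, hxy⟩
  -- This path runs from V t x at s = 0 to W t x at s = t; it is constant because its right
  -- derivative vanishes.
  set φ : ℝ → Z := fun s => V (max (t - s) 0) (W (max s 0) x) with hφ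
  have hφc : Continuous φ := (hV.continuous_uncurry hM).comp
    ((by fun_prop : Continuous fun s : ℝ => t - s).prodMk (hW.continuous_max x))
  have hderiv : ∀ s ∈ Set.Ico 0 t, HasDerivWithinAt φ 0 (Set.Ici s) s := by
    intro s hs
    rw [← hasDerivWithinAt_Ioi_iff_Ici, hasDerivWithinAt_iff_tendsto_slope' (by simp)]
    set z := W s x
    have hz : HasGenValue W z (W s y) := hxy.apply hW hs.1
    have hd := hz.sub ((h _ _).2 hz)
    have hmap : Tendsto (fun u => u - s) (𝓝[>] s) (𝓝[>] 0) := by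
      refine tendsto_nhdsWithin_iff.2 ⟨?_, ?_⟩
      · have : Tendsto (fun u : ℝ => u - s) (𝓝 s) (𝓝 (s - s)) := by
          exact (continuous_id.sub continuous_const).tendsto s
        rw [sub_self] at this
        exact this.mono_left nhdsWithin_le_nhds
      · filter_upwards [self_mem_nhdsWithin] with u hu
        exact sub_pos.2 (Set.mem_Ioi.1 hu)
    have hd' := ((hd.comp hmap).norm).const_mul M
    rw [sub_self, norm_zero, mul_zero] at hd'
    refine squeeze_zero_norm' ?_ hd'
    filter_upwards [self_mem_nhdsWithin, Ioo_mem_nhdsGT hs.2] with u hu hu'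
    have hus : 0 ≤ u - s := hu'.1.le |> sub_nonneg.2
    have htu : 0 ≤ t - u := sub_nonneg.2 hu'.2.le
    -- The slope is V (t - u) applied to the difference of the two generator quotients at `z`. Both
    -- have the same limit, and the uniform bound on V removes the dependence on `u`.
    have e : slope φ s u =
        V (t - u) ((u - s)⁻¹ • (W (u - s) z - z) - (u - s)⁻¹ • (V (u - s) z - z)) := by
      have e1 : V (t - s) z = V (t - u) (V (u - s) z) := by
        rw [← hV.apply_add htu hus]; congr 2; ring
      have e2 : W u x = W (u - s) z := by
        rw [← hW.apply_add hus hs.1]; congr 2; ring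
      rw [slope_def_module, ← smul_sub, (V (t - u)).map_smul_of_tower, hφ]
      simp only [max_eq_left htu, max_eq_left (sub_nonneg.2 hs.2.le), max_eq_left hs.1,
        max_eq_left (hs.1.trans hu'.1.le)]
      rw [sub_sub_sub_cancel_right, map_sub, ← e1, ← e2]
    rw [e]
    exact (V (t - u)).le_of_opNorm_le (hM _ htu) _
  have := constant_of_has_deriv_right_zero hφc.continuousOn hderiv t ⟨ht, le_rfl⟩
  simp only [hφ, sub_self, max_self, sub_zero, max_eq_left ht, hV.apply_zero, hW.apply_zero]
    at this
  exact this.symm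

end Semigroup

/-! ### Bounded perturbation through the Volterra equation -/

section Perturbation

variable {𝕜 Z : Type*} [RCLike 𝕜] [NormedAddCommGroup Z] [NormedSpace 𝕜 Z] [NormedSpace ℝ Z]

/-- The Duhamel integral `∫₀ᵗ T (t - s) Q f(s) ds`, extended by `0` to negative `t`. -/
noncomputable def duhamel (T : ℝ → Z →L[𝕜] Z) (Q : Z →L[𝕜] Z) (f : ℝ → Z) (t : ℝ) : Z :=
  ∫ s in (0 : ℝ)..max t 0, T (max (t - s) 0) (Q (f s))

omit [NormedSpace ℝ Z] in
theorem continuous_duhamel_integrand {T : ℝ → Z →L[𝕜] Z} (hT : IsC0Semigroup T) {M : ℝ}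
    (hM : ∀ t, 0 ≤ t → ‖T t‖ ≤ M) (Q : Z →L[𝕜] Z) {f : ℝ → Z} (hf : Continuous f) :
    Continuous fun p : ℝ × ℝ => T (max (p.1 - p.2) 0) (Q (f p.2)) :=
  (hT.continuous_uncurry hM).comp ((by fun_prop : Continuous fun p : ℝ × ℝ => p.1 - p.2).prodMk
    (by fun_prop : Continuous fun p : ℝ × ℝ => Q (f p.2)))

theorem continuous_duhamel {T : ℝ → Z →L[𝕜] Z} (hT : IsC0Semigroup T) {M : ℝ}
    (hM : ∀ t, 0 ≤ t → ‖T t‖ ≤ M) (Q : Z →L[𝕜] Z) {f : ℝ → Z} (hf : Continuous f) :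
    Continuous (duhamel T Q f) :=
  intervalIntegral.continuous_parametric_intervalIntegral_of_continuous
    (continuous_duhamel_integrand hT hM Q hf) (by fun_prop)

theorem duhamel_of_nonneg {T : ℝ → Z →L[𝕜] Z} {Q : Z →L[𝕜] Z} {f : ℝ → Z} {t : ℝ} (ht : 0 ≤ t) :
    duhamel T Q f t = ∫ s in (0 : ℝ)..t, T (max (t - s) 0) (Q (f s)) := by
  rw [duhamel, max_eq_left ht]

theorem duhamel_of_nonpos {T : ℝ → Z →L[𝕜] Z} {Q : Z →L[𝕜] Z} {f : ℝ → Z} {t : ℝ} (ht : t ≤ 0) :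
    duhamel T Q f t = 0 := by
  rw [duhamel, max_eq_right ht, intervalIntegral.integral_same]

/-- The integral is split at `s`: T t factors out of the early part, and the late part is
translated. This cocycle identity is behind the semigroup law of the perturbed family. -/
theorem duhamel_add [IsScalarTower ℝ 𝕜 Z] [CompleteSpace Z] {T : ℝ → Z →L[𝕜] Z}
    (hT : IsC0Semigroup T) {M : ℝ} (hM : ∀ t, 0 ≤ t → ‖T t‖ ≤ M) (Q : Z →L[𝕜] Z) {f : ℝ → Z}
    (hf : Continuous f) {s t : ℝ} (hs : 0 ≤ s) (ht : 0 ≤ t) :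
    duhamel T Q f (t + s) = T t (duhamel T Q f s) + duhamel T Q (fun r => f (max r 0 + s)) t := by
  have hc := continuous_duhamel_integrand hT hM Q hf
  have hi : ∀ r a b : ℝ, IntervalIntegrable (fun s => T (max (r - s) 0) (Q (f s)))
      MeasureTheory.volume a b := fun r a b =>
    (hc.comp (by fun_prop : Continuous fun s : ℝ => (r, s))).intervalIntegrable a b
  rw [duhamel_of_nonneg (add_nonneg ht hs), duhamel_of_nonneg hs, duhamel_of_nonneg ht,
    ← ContinuousLinearMap.intervalIntegral_comp_comm _ (hi s 0 s),
    ← intervalIntegral.integral_add_adjacent_intervals (hi (t + s) 0 s) (hi (t + s) s (t + s))]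
  congr 1
  · refine intervalIntegral.integral_congr fun r hr => ?_
    rw [Set.uIcc_of_le hs] at hr
    have h1 : 0 ≤ s - r := sub_nonneg.2 hr.2
    rw [max_eq_left h1, ← hT.apply_add ht h1, add_sub_assoc, max_eq_left (add_nonneg ht h1)]
  · have := intervalIntegral.integral_comp_add_right
      (fun r => T (max (t + s - r) 0) (Q (f r))) s (a := 0) (b := t)
    rw [zero_add] at this
    rw [← this]
    refine intervalIntegral.integral_congr fun r hr => ?_
    rw [Set.uIcc_of_le ht] at hr
    rw [max_eq_left hr.1, add_sub_add_right_eq_sub]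

/-- The orbit map `x ↦ (t ↦ T t x)` of a bounded `C₀`-semigroup, with values constant for `t ≤ 0`. -/
noncomputable def orbitCLM {T : ℝ → Z →L[𝕜] Z} (hT : IsC0Semigroup T) {M : ℝ}
    (hM : ∀ t, 0 ≤ t → ‖T t‖ ≤ M) : Z →L[𝕜] (ℝ →ᵇ Z) :=
  LinearMap.mkContinuous
    { toFun := fun x => BoundedContinuousFunction.ofNormedAddCommGroup (fun t => T (max t 0) x)
        (hT.continuous_max x) (M * ‖x‖)
        fun t => (T _).le_of_opNorm_le (hM _ (le_max_right t 0)) x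
      map_add' := fun x y => by ext t; exact (T _).map_add x y
      map_smul' := fun c x => by ext t; exact (T _).map_smul c x }
    M fun x => BoundedContinuousFunction.norm_ofNormedAddCommGroup_le _
      (mul_nonneg ((norm_nonneg _).trans (hM 0 le_rfl)) (norm_nonneg x))
      fun t => (T _).le_of_opNorm_le (hM _ (le_max_right t 0)) x

theorem norm_duhamel_le {T : ℝ → Z →L[𝕜] Z} {Q : Z →L[𝕜] Z} {f : ℝ → Z} {c : ℝ} (hc : 0 ≤ c)
    (h : ∀ t, 0 ≤ t → ‖duhamel T Q f t‖ ≤ c) (t : ℝ) : ‖duhamel T Q f t‖ ≤ c := by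
  rcases le_total 0 t with ht | ht
  · exact h t ht
  · rwa [duhamel_of_nonpos ht, norm_zero]

/-- The Volterra operator `f ↦ duhamel T Q f` on bounded continuous functions. -/
noncomputable def volterraCLM [IsScalarTower ℝ 𝕜 Z] {T : ℝ → Z →L[𝕜] Z} (hT : IsC0Semigroup T) {M : ℝ}
    (hM : ∀ t, 0 ≤ t → ‖T t‖ ≤ M) (Q : Z →L[𝕜] Z) {κ : ℝ} (hκ0 : 0 ≤ κ)
    (hκ : ∀ f : ℝ →ᵇ Z, ∀ t, 0 ≤ t → ‖duhamel T Q f t‖ ≤ κ * ‖f‖) :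
    (ℝ →ᵇ Z) →L[𝕜] (ℝ →ᵇ Z) :=
  have hi : ∀ (f : ℝ →ᵇ Z) (r a b : ℝ), IntervalIntegrable
      (fun s => T (max (r - s) 0) (Q (f s))) MeasureTheory.volume a b := fun f r a b =>
    ((continuous_duhamel_integrand hT hM Q f.continuous).comp
      (by fun_prop : Continuous fun s : ℝ => (r, s))).intervalIntegrable a b
  LinearMap.mkContinuous
    { toFun := fun f => BoundedContinuousFunction.ofNormedAddCommGroup (duhamel T Q f)
        (continuous_duhamel hT hM Q f.continuous) (κ * ‖f‖)
        (norm_duhamel_le (by positivity) (hκ f))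
      map_add' := fun f g => by
        ext t
        change duhamel T Q (f + g) t = duhamel T Q f t + duhamel T Q g t
        simp only [duhamel]
        rw [← intervalIntegral.integral_add (hi f t _ _) (hi g t _ _)]
        simp
      map_smul' := fun c f => by
        ext t
        change duhamel T Q (c • f) t = c • duhamel T Q f t
        simp only [duhamel]
        rw [← intervalIntegral.integral_smul]
        simp }
    κ fun f => BoundedContinuousFunction.norm_ofNormedAddCommGroup_le _
      (mul_nonneg hκ0 (norm_nonneg f)) (norm_duhamel_le (by positivity) (hκ f))

/-- If the Volterra operator of `T` and `Q` is a strict contraction, then the generator of `T`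
perturbed by `Q` generates a bounded `C₀`-semigroup. -/
theorem IsC0Semigroup.exists_perturbation [IsScalarTower ℝ 𝕜 Z] [CompleteSpace Z]
    {T : ℝ → Z →L[𝕜] Z} (hT : IsC0Semigroup T) {M : ℝ} (hM : ∀ t, 0 ≤ t → ‖T t‖ ≤ M)
    (Q : Z →L[𝕜] Z) {κ : ℝ} (hκ0 : 0 ≤ κ) (hκ1 : κ < 1)
    (hκ : ∀ f : ℝ →ᵇ Z, ∀ t, 0 ≤ t → ‖duhamel T Q f t‖ ≤ κ * ‖f‖) :
    ∃ (V : ℝ → Z →L[𝕜] Z) (N : ℝ), IsC0Semigroup V ∧ (∀ t, 0 ≤ t → ‖V t‖ ≤ N) ∧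
      ∀ x y, HasGenValue V x y ↔ HasGenValue T x (y - Q x) := by
  set K := volterraCLM hT hM Q hκ0 hκ
  set Φ := orbitCLM hT hM
  have hK : ‖K‖ < 1 := by
    refine (ContinuousLinearMap.opNorm_le_bound _ hκ0 fun f => ?_).trans_lt hκ1
    exact BoundedContinuousFunction.norm_ofNormedAddCommGroup_le _
      (mul_nonneg hκ0 (norm_nonneg f)) (norm_duhamel_le (by positivity) (hκ f))
  -- Neumann series: S x below is the only bounded continuous solution of v = T x + K v.
  obtain ⟨u, hu⟩ := isUnit_one_sub_of_norm_lt_one hK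
  set R : (ℝ →ᵇ Z) →L[𝕜] (ℝ →ᵇ Z) := ↑u⁻¹ with hR
  have hinv : ∀ f, (1 - K) (R f) = f := fun f => by
    rw [← hu, ← mul_apply_eq_comp, hR, Units.mul_inv]; rfl
  have hinv' : ∀ f, R ((1 - K) f) = f := fun f => by
    rw [← hu, ← mul_apply_eq_comp, hR, Units.inv_mul]; rfl
  set S : Z →L[𝕜] (ℝ →ᵇ Z) := R.comp Φ with hS
  have heq : ∀ x t, S x t = T (max t 0) x + duhamel T Q (S x) t := fun x t => by
    have := congrArg (fun f : ℝ →ᵇ Z => f t) (hinv (Φ x))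
    exact sub_eq_iff_eq_add.1 this
  have huniq : ∀ x (g : ℝ →ᵇ Z), (∀ t, g t = T (max t 0) x + duhamel T Q g t) → g = S x := by
    intro x g hg
    rw [← hinv' g, hS]
    change R _ = R _
    congr 1
    ext t
    exact sub_eq_iff_eq_add.2 (hg t)
  have hneg : ∀ x t, t ≤ 0 → S x t = x := fun x t ht => by
    rw [heq, duhamel_of_nonpos ht, max_eq_right ht, hT.apply_zero, add_zero]
  set V : ℝ → Z →L[𝕜] Z := fun t => (BoundedContinuousFunction.evalCLM 𝕜 t).comp S with hV
  have hVS : ∀ t x, V t x = S x t := fun _ _ => rfl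
  refine ⟨V, ‖S‖, ⟨?_, ?_, ?_⟩, ?_, ?_⟩
  · ext x
    exact hneg x 0 le_rfl
  · intro t s ht hs
    ext x
    change S x (t + s) = S (S x s) t
    -- The orbit shifted by `s` solves the Volterra equation with initial value S x s, so uniqueness
    -- gives the semigroup law. The equation must hold on all of ℝ, hence the shift is frozen for r
    -- ≤ 0.
    have := huniq (S x s) ((S x).compContinuous ⟨fun r => max r 0 + s, by fun_prop⟩) ?_
    · rw [← this]
      simp [max_eq_left ht]
    · intro r
      change S x (max r 0 + s) = T (max r 0) (S x s) + duhamel T Q (fun r => S x (max r 0 + s)) r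
      rcases le_total 0 r with hr | hr
      · rw [max_eq_left hr, heq x (r + s), duhamel_add hT hM Q (S x).continuous hs hr, heq x s,
          max_eq_left hs, max_eq_left (add_nonneg hr hs), hT.apply_add hr hs, _root_.map_add, add_assoc]
      · rw [max_eq_right hr, duhamel_of_nonpos hr, zero_add, hT.apply_zero, add_zero]
  · intro x
    exact (S x).continuous.continuousOn
  · intro t _
    refine ContinuousLinearMap.opNorm_le_bound _ (norm_nonneg _) fun x => ?_
    exact ((S x).norm_coe_le_norm t).trans (S.le_opNorm x)
  · intro x y
    -- The Duhamel term divided by `t` tends to Q x, so the two generators differ exactly by Q, on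
    -- the same domain.
    have havg := tendsto_average_diagonal
      (F := fun t s => T (max (t - s) 0) (Q (S x s)))
      (continuous_duhamel_integrand hT hM Q (S x).continuous)
    have h0 : T (max ((0 : ℝ) - 0) 0) (Q (S x 0)) = Q x := by
      rw [sub_zero, max_self, hT.apply_zero, hneg x 0 le_rfl]
    rw [h0] at havg
    have hdiff : ∀ t > 0, t⁻¹ • (V t x - x) = t⁻¹ • (T t x - x) +
        t⁻¹ • ∫ s in (0 : ℝ)..t, T (max (t - s) 0) (Q (S x s)) := fun t ht => by
      rw [hVS, heq, duhamel_of_nonneg (le_of_lt ht), max_eq_left (le_of_lt ht), ← smul_add]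
      congr 1
      abel
    constructor
    · intro h
      refine (Tendsto.sub h havg).congr' ?_
      filter_upwards [self_mem_nhdsWithin] with t ht
      rw [hdiff t ht, add_sub_cancel_right]
    · intro h
      have := Tendsto.add h havg
      rw [sub_add_cancel] at this
      refine this.congr' ?_
      filter_upwards [self_mem_nhdsWithin] with t ht
      rw [hdiff t ht]

end Perturbation

/-! ### Rescaling, products and conjugation of semigroups -/

section Constructions

variable {𝕜 Z W : Type*} [RCLike 𝕜] [NormedAddCommGroup Z] [NormedSpace 𝕜 Z] [NormedSpace ℝ Z]
  [NormedAddCommGroup W] [NormedSpace 𝕜 W] [NormedSpace ℝ W]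

/-- The rescaled family `t ↦ exp (δ t) T t`. -/
noncomputable def rescale (δ : ℝ) (T : ℝ → Z →L[𝕜] Z) (t : ℝ) : Z →L[𝕜] Z :=
  ((Real.exp (δ * t) : ℝ) : 𝕜) • T t

theorem rescale_apply [IsScalarTower ℝ 𝕜 Z] (δ : ℝ) (T : ℝ → Z →L[𝕜] Z) (t : ℝ) (x : Z) :
    rescale δ T t x = Real.exp (δ * t) • T t x := by
  rw [RCLike.real_smul_eq_coe_smul (K := 𝕜)]; rfl

omit [NormedSpace ℝ Z] in
theorem norm_rescale (δ : ℝ) (T : ℝ → Z →L[𝕜] Z) (t : ℝ) :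
    ‖rescale δ T t‖ = Real.exp (δ * t) * ‖T t‖ := by
  rw [rescale, norm_smul, RCLike.norm_ofReal, Real.abs_exp]

theorem IsC0Semigroup.rescale [IsScalarTower ℝ 𝕜 Z] {T : ℝ → Z →L[𝕜] Z} (hT : IsC0Semigroup T)
    (δ : ℝ) : IsC0Semigroup (rescale δ T) where
  map_zero := by ext x; simp [rescale_apply, hT.apply_zero]
  map_add s t hs ht := by
    ext x
    rw [ContinuousLinearMap.comp_apply, rescale_apply, rescale_apply, rescale_apply,
      (T s).map_smul_of_tower, smul_smul, ← Real.exp_add, hT.apply_add hs ht, mul_add]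
  continuousOn x := by
    simp only [rescale_apply]
    exact (by fun_prop : Continuous fun t => Real.exp (δ * t)).continuousOn.smul (hT.continuousOn x)

theorem HasGenValue.rescale [IsScalarTower ℝ 𝕜 Z] {T : ℝ → Z →L[𝕜] Z} {x y : Z}
    (h : HasGenValue T x y) (δ : ℝ) : HasGenValue (rescale δ T) x (y + δ • x) := by
  have h1 : Tendsto (fun t : ℝ => Real.exp (δ * t)) (𝓝[>] 0) (𝓝 1) := by
    have : Tendsto (fun t : ℝ => Real.exp (δ * t)) (𝓝 0) (𝓝 (Real.exp (δ * 0))) :=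
      (by fun_prop : Continuous fun t => Real.exp (δ * t)).tendsto 0
    rw [mul_zero, Real.exp_zero] at this
    exact this.mono_left nhdsWithin_le_nhds
  have h2 : Tendsto (fun t : ℝ => t⁻¹ * (Real.exp (δ * t) - 1)) (𝓝[>] 0) (𝓝 δ) := by
    have hd : HasDerivAt (fun t : ℝ => Real.exp (δ * t)) δ 0 := by
      simpa using ((hasDerivAt_id (0 : ℝ)).const_mul δ).exp
    have := (hasDerivAt_iff_tendsto_slope_zero.1 hd).mono_left
      (nhdsWithin_mono 0 fun t (ht : t ∈ Set.Ioi (0 : ℝ)) => (ne_of_gt ht : t ≠ 0))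
    simpa using this
  have h3 := (h1.smul h).add (h2.smul_const x)
  rw [one_smul] at h3
  refine h3.congr fun t => ?_
  rw [rescale_apply]
  module

theorem hasGenValue_rescale_iff [IsScalarTower ℝ 𝕜 Z] {T : ℝ → Z →L[𝕜] Z} {x y : Z} (δ : ℝ) :
    HasGenValue (rescale δ T) x y ↔ HasGenValue T x (y - δ • x) := by
  refine ⟨fun h => ?_, fun h => by simpa using h.rescale δ⟩
  have := h.rescale (-δ)
  have e : rescale (-δ) (rescale δ T) = T := by
    ext t x
    rw [rescale_apply, rescale_apply, smul_smul, ← Real.exp_add]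
    simp
  rwa [e, neg_smul, ← sub_eq_add_neg] at this

omit [NormedSpace ℝ Z] [NormedSpace ℝ W] in
theorem IsC0Semigroup.prodMap {T : ℝ → Z →L[𝕜] Z} {U : ℝ → W →L[𝕜] W} (hT : IsC0Semigroup T)
    (hU : IsC0Semigroup U) : IsC0Semigroup fun t => (T t).prodMap (U t) where
  map_zero := by rw [hT.map_zero, hU.map_zero]; rfl
  map_add s t hs ht := by rw [hT.map_add s t hs ht, hU.map_add s t hs ht]; rfl
  continuousOn x := (hT.continuousOn x.1).prodMk (hU.continuousOn x.2)

theorem hasGenValue_prodMap_iff {T : ℝ → Z →L[𝕜] Z} {U : ℝ → W →L[𝕜] W} {x y : Z × W} :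
    HasGenValue (fun t => (T t).prodMap (U t)) x y ↔
      HasGenValue T x.1 y.1 ∧ HasGenValue U x.2 y.2 :=
  Prod.tendsto_iff _ _

omit [NormedSpace ℝ Z] [NormedSpace ℝ W] in
theorem IsC0Semigroup.conj {T : ℝ → Z →L[𝕜] Z} (hT : IsC0Semigroup T) (e : W ≃L[𝕜] Z) :
    IsC0Semigroup fun t => (e.symm : Z →L[𝕜] W).comp ((T t).comp (e : W →L[𝕜] Z)) where
  map_zero := by ext x; simp [hT.map_zero]
  map_add s t hs ht := by ext x; simp [hT.map_add s t hs ht]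
  continuousOn x := e.symm.continuous.comp_continuousOn (hT.continuousOn (e x))

theorem hasGenValue_conj_iff [IsScalarTower ℝ 𝕜 Z] [IsScalarTower ℝ 𝕜 W] {T : ℝ → Z →L[𝕜] Z}
    (e : W ≃L[𝕜] Z) {x y : W} :
    HasGenValue (fun t => (e.symm : Z →L[𝕜] W).comp ((T t).comp (e : W →L[𝕜] Z))) x y ↔
      HasGenValue T (e x) (e y) := by
  have h : ∀ t : ℝ, t⁻¹ • (e.symm (T t (e x)) - x) = e.symm (t⁻¹ • (T t (e x) - e x)) := fun t => by
    change _ = (e.symm : Z →L[𝕜] W) _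
    rw [ContinuousLinearMap.map_smul_of_tower]
    simp
  constructor
  · intro H
    refine ((e.continuous.tendsto y).comp H).congr fun t => ?_
    change e (t⁻¹ • (e.symm (T t (e x)) - x)) = _
    rw [h, e.apply_symm_apply]
  · intro H
    have := (e.symm.continuous.tendsto (e y)).comp H
    rw [e.symm_apply_apply] at this
    exact this.congr fun t => (h t).symm

end Constructions

/-! ### Small-gain stability for off-diagonal perturbations -/

section OffDiagonal

variable {𝕜 X Y : Type*} [RCLike 𝕜]
  [NormedAddCommGroup X] [NormedSpace 𝕜 X] [NormedSpace ℝ X] [IsScalarTower ℝ 𝕜 X]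
  [NormedAddCommGroup Y] [NormedSpace 𝕜 Y] [NormedSpace ℝ Y] [IsScalarTower ℝ 𝕜 Y]

theorem integral_exp_neg_mul_sub_le {b : ℝ} (hb : 0 < b) (t : ℝ) :
    ∫ s in (0 : ℝ)..t, Real.exp (-b * (t - s)) ≤ 1 / b := by
  have hd : ∀ s ∈ Set.uIcc 0 t,
      HasDerivAt (fun s => Real.exp (-b * (t - s)) / b) (Real.exp (-b * (t - s))) s := fun s _ => by
    have := ((((hasDerivAt_id s).const_sub t).const_mul (-b)).exp).div_const b
    refine this.congr_deriv ?_
    rw [mul_neg_one, neg_neg, mul_div_cancel_right₀ _ hb.ne']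
    rfl
  rw [intervalIntegral.integral_eq_sub_of_hasDerivAt hd
    (Continuous.intervalIntegrable (by fun_prop) _ _), sub_self, mul_zero, Real.exp_zero]
  exact sub_le_self _ (by positivity)

omit [IsScalarTower ℝ 𝕜 X] in
-- The kernel M exp (-b t) has mass M / b on the half-line; this is the gain of one diagonal block.
theorem norm_integral_convolution_le {T : ℝ → X →L[𝕜] X} {M b R : ℝ} (hb : 0 < b)
    (hM : ∀ t, 0 ≤ t → ‖T t‖ ≤ M * Real.exp (-b * t)) {f : ℝ → X} (hR : ∀ s, ‖f s‖ ≤ R)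
    {t : ℝ} (ht : 0 ≤ t) :
    ‖∫ s in (0 : ℝ)..t, T (max (t - s) 0) (f s)‖ ≤ M * R / b := by
  have hM0 : 0 ≤ M := by simpa using (norm_nonneg _).trans (hM 0 le_rfl)
  have hR0 : 0 ≤ R := (norm_nonneg _).trans (hR 0)
  calc ‖∫ s in (0 : ℝ)..t, T (max (t - s) 0) (f s)‖
      ≤ ∫ s in (0 : ℝ)..t, M * R * Real.exp (-b * (t - s)) := by
        refine intervalIntegral.norm_integral_le_of_norm_le ht ?_
          (Continuous.intervalIntegrable (by fun_prop) _ _)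
        refine Eventually.of_forall fun s hs => ?_
        rw [max_eq_left (sub_nonneg.2 hs.2)]
        refine ((T _).le_opNorm _).trans ?_
        calc ‖T (t - s)‖ * ‖f s‖ ≤ (M * Real.exp (-b * (t - s))) * R :=
              mul_le_mul (hM _ (sub_nonneg.2 hs.2)) (hR s) (norm_nonneg _) (by positivity)
          _ = _ := by ring
    _ = M * R * ∫ s in (0 : ℝ)..t, Real.exp (-b * (t - s)) :=
        intervalIntegral.integral_const_mul _ _
    _ ≤ M * R * (1 / b) := by gcongr; exact integral_exp_neg_mul_sub_le hb t
    _ = M * R / b := by ring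

/-- The operator `(u, x) ↦ (P x, C u)`. -/
def offDiagonal (P : Y →L[𝕜] X) (C : X →L[𝕜] Y) : X × Y →L[𝕜] X × Y :=
  (P.comp (ContinuousLinearMap.snd 𝕜 X Y)).prod (C.comp (ContinuousLinearMap.fst 𝕜 X Y))

omit [NormedSpace ℝ X] [IsScalarTower ℝ 𝕜 X] in
theorem norm_le_of_le_mul_exp_neg {T : ℝ → X →L[𝕜] X} {M b : ℝ} (hb : 0 < b)
    (h : ∀ t, 0 ≤ t → ‖T t‖ ≤ M * Real.exp (-b * t)) (t : ℝ) (ht : 0 ≤ t) : ‖T t‖ ≤ M := by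
  have hM0 : 0 ≤ M := by simpa using (norm_nonneg _).trans (h 0 le_rfl)
  refine (h t ht).trans (mul_le_of_le_one_right hM0 (Real.exp_le_one_iff.2 ?_))
  nlinarith

omit [NormedSpace ℝ X] [IsScalarTower ℝ 𝕜 X] [NormedSpace ℝ Y] [IsScalarTower ℝ 𝕜 Y] in
theorem norm_prodMap_le {M₁ M₂ : ℝ} {S : X →L[𝕜] X} {T : Y →L[𝕜] Y}
    (hS : ‖S‖ ≤ M₁) (hT : ‖T‖ ≤ M₂) : ‖S.prodMap T‖ ≤ max M₁ M₂ := by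
  have h0 : 0 ≤ max M₁ M₂ := le_max_of_le_left ((norm_nonneg S).trans hS)
  refine ContinuousLinearMap.opNorm_le_bound _ h0 fun p => norm_prod_le_iff.2 ⟨?_, ?_⟩
  · exact (S.le_of_opNorm_le (hS.trans (le_max_left _ _)) p.1).trans
      (mul_le_mul_of_nonneg_left (norm_fst_le p) h0)
  · exact (T.le_of_opNorm_le (hT.trans (le_max_right _ _)) p.2).trans
      (mul_le_mul_of_nonneg_left (norm_snd_le p) h0)

omit [IsScalarTower ℝ 𝕜 X] [IsScalarTower ℝ 𝕜 Y] in
-- Each output component sees a single off-diagonal entry, so in the sup norm the two gains combine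
-- as a maximum, not a sum.
theorem norm_duhamel_offDiagonal_le [CompleteSpace X] [CompleteSpace Y]
    {T₁ : ℝ → X →L[𝕜] X} {T₂ : ℝ → Y →L[𝕜] Y} (hT₁ : IsC0Semigroup T₁) (hT₂ : IsC0Semigroup T₂)
    {M₁ M₂ b₁ b₂ : ℝ} (hb₁ : 0 < b₁) (hb₂ : 0 < b₂)
    (hM₁ : ∀ t, 0 ≤ t → ‖T₁ t‖ ≤ M₁ * Real.exp (-b₁ * t))
    (hM₂ : ∀ t, 0 ≤ t → ‖T₂ t‖ ≤ M₂ * Real.exp (-b₂ * t))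
    (P : Y →L[𝕜] X) (C : X →L[𝕜] Y) (f : ℝ →ᵇ X × Y) {t : ℝ} (ht : 0 ≤ t) :
    ‖duhamel (fun t => (T₁ t).prodMap (T₂ t)) (offDiagonal P C) f t‖ ≤
      max (M₁ * ‖P‖ / b₁) (M₂ * ‖C‖ / b₂) * ‖f‖ := by
  have hi : IntervalIntegrable (fun s => (T₁ (max (t - s) 0)).prodMap (T₂ (max (t - s) 0))
      (offDiagonal P C (f s))) MeasureTheory.volume 0 t :=
    ((continuous_duhamel_integrand (hT₁.prodMap hT₂)
      (fun t ht => norm_prodMap_le (norm_le_of_le_mul_exp_neg hb₁ hM₁ t ht)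
        (norm_le_of_le_mul_exp_neg hb₂ hM₂ t ht)) (offDiagonal P C) f.continuous).comp
      (by fun_prop : Continuous fun s : ℝ => (t, s))).intervalIntegrable _ _
  rw [duhamel_of_nonneg ht]
  refine norm_prod_le_iff.2 ⟨?_, ?_⟩
  · have h := (ContinuousLinearMap.fst ℝ X Y).intervalIntegral_comp_comm hi
    simp only [ContinuousLinearMap.coe_fst'] at h
    rw [← h]
    refine (norm_integral_convolution_le (R := ‖P‖ * ‖f‖) (f := fun s => P (f s).2) hb₁ hM₁
      (fun s => ?_) ht).trans ?_
    · exact P.le_opNorm_of_le ((norm_snd_le _).trans (f.norm_coe_le_norm s))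
    · rw [← mul_assoc, mul_div_right_comm]
      gcongr
      exact le_max_left _ _
  · have h := (ContinuousLinearMap.snd ℝ X Y).intervalIntegral_comp_comm hi
    simp only [ContinuousLinearMap.coe_snd'] at h
    rw [← h]
    refine (norm_integral_convolution_le (R := ‖C‖ * ‖f‖) (f := fun s => C (f s).1) hb₂ hM₂
      (fun s => ?_) ht).trans ?_
    · exact C.le_opNorm_of_le ((norm_fst_le _).trans (f.norm_coe_le_norm s))
    · rw [← mul_assoc, mul_div_right_comm]
      gcongr
      exact le_max_right _ _

/-- Off-diagonal perturbations of a diagonal semigroup that are small in each component. -/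
theorem exists_stable_offDiagonal_of_lt [CompleteSpace X] [CompleteSpace Y]
    {T₁ : ℝ → X →L[𝕜] X} {T₂ : ℝ → Y →L[𝕜] Y} (hT₁ : IsC0Semigroup T₁) (hT₂ : IsC0Semigroup T₂)
    {M₁ M₂ a₁ a₂ : ℝ}
    (hM₁ : ∀ t, 0 ≤ t → ‖T₁ t‖ ≤ M₁ * Real.exp (-a₁ * t))
    (hM₂ : ∀ t, 0 ≤ t → ‖T₂ t‖ ≤ M₂ * Real.exp (-a₂ * t))
    (P : Y →L[𝕜] X) (C : X →L[𝕜] Y) (hP : M₁ * ‖P‖ < a₁) (hC : M₂ * ‖C‖ < a₂) :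
    ∃ V : ℝ → X × Y →L[𝕜] X × Y, IsC0Semigroup V ∧ UniformlyExponentiallyStable V ∧
      ∀ p q, HasGenValue V p q ↔
        HasGenValue T₁ p.1 (q.1 - P p.2) ∧ HasGenValue T₂ p.2 (q.2 - C p.1) := by
  have hM₁0 : 0 ≤ M₁ := by simpa using (norm_nonneg _).trans (hM₁ 0 le_rfl)
  have hM₂0 : 0 ≤ M₂ := by simpa using (norm_nonneg _).trans (hM₂ 0 le_rfl)
  -- The strict inequalities leave room to trade a decay rate δ from both blocks; it becomes the
  -- decay rate of the perturbed semigroup.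
  obtain ⟨δ, hδ, hδ'⟩ := exists_between (lt_min (sub_pos.2 hP) (sub_pos.2 hC))
  have hδ₁ : M₁ * ‖P‖ < a₁ - δ := by linarith [hδ'.trans_le (min_le_left _ _)]
  have hδ₂ : M₂ * ‖C‖ < a₂ - δ := by linarith [hδ'.trans_le (min_le_right _ _)]
  have hb₁ : 0 < a₁ - δ := lt_of_le_of_lt (by positivity) hδ₁
  have hb₂ : 0 < a₂ - δ := lt_of_le_of_lt (by positivity) hδ₂
  have hR₁ : ∀ t, 0 ≤ t → ‖rescale δ T₁ t‖ ≤ M₁ * Real.exp (-(a₁ - δ) * t) := fun t ht => by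
    rw [norm_rescale, show -(a₁ - δ) * t = δ * t + -a₁ * t by ring, Real.exp_add, mul_left_comm]
    exact mul_le_mul_of_nonneg_left (hM₁ t ht) (Real.exp_nonneg _)
  have hR₂ : ∀ t, 0 ≤ t → ‖rescale δ T₂ t‖ ≤ M₂ * Real.exp (-(a₂ - δ) * t) := fun t ht => by
    rw [norm_rescale, show -(a₂ - δ) * t = δ * t + -a₂ * t by ring, Real.exp_add, mul_left_comm]
    exact mul_le_mul_of_nonneg_left (hM₂ t ht) (Real.exp_nonneg _)
  obtain ⟨V, N, hV, hN, hgen⟩ := ((hT₁.rescale δ).prodMap (hT₂.rescale δ)).exists_perturbation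
    (fun t ht => norm_prodMap_le (norm_le_of_le_mul_exp_neg hb₁ hR₁ t ht)
      (norm_le_of_le_mul_exp_neg hb₂ hR₂ t ht)) (offDiagonal P C)
    (κ := max (M₁ * ‖P‖ / (a₁ - δ)) (M₂ * ‖C‖ / (a₂ - δ))) (by positivity)
    (max_lt ((div_lt_one hb₁).2 hδ₁) ((div_lt_one hb₂).2 hδ₂))
    fun f t ht => norm_duhamel_offDiagonal_le (hT₁.rescale δ) (hT₂.rescale δ) hb₁ hb₂ hR₁ hR₂ P C f ht
  refine ⟨rescale (-δ) V, hV.rescale _, ⟨N, δ, hδ, fun t ht => ?_⟩, fun p q => ?_⟩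
  · rw [norm_rescale, mul_comm]
    exact mul_le_mul_of_nonneg_right (hN t ht) (Real.exp_nonneg _)
  · rw [hasGenValue_rescale_iff, hgen, hasGenValue_prodMap_iff, hasGenValue_rescale_iff,
      hasGenValue_rescale_iff]
    have e1 : (q - -δ • p - offDiagonal P C p).1 - δ • p.1 = q.1 - P p.2 := by
      change q.1 - -δ • p.1 - P p.2 - δ • p.1 = _
      module
    have e2 : (q - -δ • p - offDiagonal P C p).2 - δ • p.2 = q.2 - C p.1 := by
      change q.2 - -δ • p.2 - C p.1 - δ • p.2 = _
      module
    rw [e1, e2]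

omit [NormedSpace ℝ X] [IsScalarTower ℝ 𝕜 X] [NormedSpace ℝ Y] [IsScalarTower ℝ 𝕜 Y] in
theorem UniformlyExponentiallyStable.conj {T : ℝ → X →L[𝕜] X} (hT : UniformlyExponentiallyStable T)
    (e : Y ≃L[𝕜] X) : UniformlyExponentiallyStable
      fun t => (e.symm : X →L[𝕜] Y).comp ((T t).comp (e : Y →L[𝕜] X)) := by
  obtain ⟨M, ω, hω, h⟩ := hT
  refine ⟨‖(e.symm : X →L[𝕜] Y)‖ * (M * ‖(e : Y →L[𝕜] X)‖), ω, hω, fun t ht => ?_⟩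
  calc _ ≤ ‖(e.symm : X →L[𝕜] Y)‖ * (‖T t‖ * ‖(e : Y →L[𝕜] X)‖) :=
        (ContinuousLinearMap.opNorm_comp_le _ _).trans
          (mul_le_mul_of_nonneg_left (ContinuousLinearMap.opNorm_comp_le _ _) (norm_nonneg _))
    _ ≤ ‖(e.symm : X →L[𝕜] Y)‖ * ((M * Real.exp (-ω * t)) * ‖(e : Y →L[𝕜] X)‖) := by
        gcongr
        exact h t ht
    _ = _ := by ring

theorem HasGenValue.const_smul {T : ℝ → X →L[𝕜] X} {x y : X} (h : HasGenValue T x y) (c : 𝕜) :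
    HasGenValue T (c • x) (c • y) := by
  refine (Tendsto.const_smul h c).congr fun t => ?_
  rw [map_smul, ← smul_sub, smul_comm]

theorem hasGenValue_const_smul_iff {T : ℝ → X →L[𝕜] X} {x y : X} {c : 𝕜} (hc : c ≠ 0) :
    HasGenValue T (c • x) (c • y) ↔ HasGenValue T x y := by
  refine ⟨fun h => ?_, fun h => h.const_smul c⟩
  simpa [smul_smul, inv_mul_cancel₀ hc] using h.const_smul c⁻¹

/-- The requirements are P / a₁ < r and r C < a₂, compatible because (P / a₁) C < a₂. -/
theorem exists_pos_scaling {P C a₁ a₂ : ℝ} (hP : 0 ≤ P) (hC : 0 ≤ C) (ha₁ : 0 < a₁)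
    (h : C * P < a₁ * a₂) : ∃ r : ℝ, 0 < r ∧ r⁻¹ * P < a₁ ∧ r * C < a₂ := by
  have hgap : 0 < a₂ - P / a₁ * C := by
    rw [sub_pos, div_mul_eq_mul_div, div_lt_iff₀ ha₁]
    linarith
  have hη : 0 < (a₂ - P / a₁ * C) / (C + 1) := by positivity
  -- Slightly above the lower bound P / a₁; the denominator C + 1 keeps the increment below the
  -- available gap and covers C = 0.
  refine ⟨P / a₁ + (a₂ - P / a₁ * C) / (C + 1), by positivity, ?_, ?_⟩
  · rw [inv_mul_lt_iff₀ (by positivity)]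
    have := mul_pos hη ha₁
    have e : P / a₁ * a₁ = P := div_mul_cancel₀ _ ha₁.ne'
    linarith
  · have : (a₂ - P / a₁ * C) / (C + 1) * C < a₂ - P / a₁ * C := by
      rw [div_mul_eq_mul_div, div_lt_iff₀ (by positivity)]
      nlinarith
    linarith

/-- Off-diagonal perturbations of a diagonal semigroup with small loop gain. -/
theorem exists_stable_offDiagonal [CompleteSpace X] [CompleteSpace Y]
    {T₁ : ℝ → X →L[𝕜] X} {T₂ : ℝ → Y →L[𝕜] Y} (hT₁ : IsC0Semigroup T₁) (hT₂ : IsC0Semigroup T₂)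
    {M₁ M₂ a₁ a₂ : ℝ} (ha₁ : 0 < a₁)
    (hM₁ : ∀ t, 0 ≤ t → ‖T₁ t‖ ≤ M₁ * Real.exp (-a₁ * t))
    (hM₂ : ∀ t, 0 ≤ t → ‖T₂ t‖ ≤ M₂ * Real.exp (-a₂ * t))
    (P : Y →L[𝕜] X) (C : X →L[𝕜] Y) (hPC : (M₂ * ‖C‖) * (M₁ * ‖P‖) < a₁ * a₂) :
    ∃ V : ℝ → X × Y →L[𝕜] X × Y, IsC0Semigroup V ∧ UniformlyExponentiallyStable V ∧
      ∀ p q, HasGenValue V p q ↔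
        HasGenValue T₁ p.1 (q.1 - P p.2) ∧ HasGenValue T₂ p.2 (q.2 - C p.1) := by
  have hM₁0 : 0 ≤ M₁ := by simpa using (norm_nonneg _).trans (hM₁ 0 le_rfl)
  have hM₂0 : 0 ≤ M₂ := by simpa using (norm_nonneg _).trans (hM₂ 0 le_rfl)
  obtain ⟨r, hr, hrP, hrC⟩ := exists_pos_scaling (mul_nonneg hM₁0 (norm_nonneg P))
    (mul_nonneg hM₂0 (norm_nonneg C)) ha₁ hPC
  have hr0 : (r : 𝕜) ≠ 0 := RCLike.ofReal_ne_zero.2 hr.ne'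
  have hnr : ‖(r : 𝕜)‖ = r := by rw [RCLike.norm_ofReal, abs_of_pos hr]
  obtain ⟨V, hV, hVs, hgen⟩ := exists_stable_offDiagonal_of_lt hT₁ hT₂ hM₁ hM₂
    ((r : 𝕜)⁻¹ • P) ((r : 𝕜) • C)
    (by rwa [norm_smul, norm_inv, hnr, mul_left_comm]) (by rwa [norm_smul, hnr, mul_left_comm])
  -- Conjugation by this weight on the second component turns r⁻¹ P, r C back into P, C.
  let e : (X × Y) ≃L[𝕜] X × Y :=
    (ContinuousLinearEquiv.refl 𝕜 X).prodCongr (ContinuousLinearEquiv.smulLeft (Units.mk0 (r : 𝕜) hr0))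
  have he : ∀ p : X × Y, e p = (p.1, (r : 𝕜) • p.2) := fun _ => rfl
  refine ⟨_, hV.conj e, hVs.conj e, fun p q => ?_⟩
  rw [hasGenValue_conj_iff, hgen, he, he]
  simp only [smul_apply, map_smul, smul_smul, mul_inv_cancel₀ hr0, one_smul,
    ← smul_sub, hasGenValue_const_smul_iff hr0]

end OffDiagonal

/-! ### Extension of bounded densely defined operators -/

namespace LinearPMap

variable {𝕜 E F : Type*} [RCLike 𝕜] [NormedAddCommGroup E] [NormedSpace 𝕜 E]
  [NormedAddCommGroup F] [NormedSpace 𝕜 F]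

theorem opNormOn_nonneg (f : E →ₗ.[𝕜] F) : 0 ≤ f.opNormOn :=
  Real.sInf_nonneg fun _ hc => hc.1

theorem IsBoundedOp.le_opNormOn {f : E →ₗ.[𝕜] F} (hf : f.IsBoundedOp) (x : f.domain) :
    ‖f x‖ ≤ f.opNormOn * ‖(x : E)‖ := by
  obtain ⟨c, hc⟩ := hf
  set s : Set ℝ := {c : ℝ | 0 ≤ c ∧ ∀ x : f.domain, ‖f x‖ ≤ c * ‖(x : E)‖} with hs
  have hne : s.Nonempty := ⟨max c 0, le_max_right _ _, fun x =>
    (hc x).trans (mul_le_mul_of_nonneg_right (le_max_left _ _) (norm_nonneg _))⟩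
  -- The admissible bounds form a closed set, so their infimum is itself a bound.
  have hcl : _root_.IsClosed s := by
    have : s = Set.Ici 0 ∩ ⋂ x : f.domain, {c : ℝ | ‖f x‖ ≤ c * ‖(x : E)‖} := by
      ext c; simp [hs]
    rw [this]
    exact isClosed_Ici.inter (isClosed_iInter fun x => isClosed_le (by fun_prop) (by fun_prop))
  exact (hcl.csInf_mem hne ⟨0, fun _ h => h.1⟩).2 x

/-- A bounded densely defined operator has a continuous extension with at most the same norm. -/
theorem IsBoundedOp.exists_extension [CompleteSpace F] {f : E →ₗ.[𝕜] F} (hf : f.IsBoundedOp)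
    (hd : Dense (f.domain : Set E)) :
    ∃ g : E →L[𝕜] F, ‖g‖ ≤ f.opNormOn ∧ ∀ x : f.domain, g x = f x := by
  have hr : DenseRange f.domain.subtype := by
    rw [DenseRange, Submodule.coe_subtype, Subtype.range_coe]
    exact hd
  exact ⟨f.toFun.extendOfNorm f.domain.subtype,
    LinearMap.opNorm_extendOfNorm_le hr f.opNormOn_nonneg hf.le_opNormOn,
    LinearMap.extendOfNorm_eq hr ⟨_, hf.le_opNormOn⟩⟩

end LinearPMap

/-! ### Generators as graphs of right derivatives -/

section Generates

variable {𝕜 E : Type*} [RCLike 𝕜] [NormedAddCommGroup E] [NormedSpace 𝕜 E] [NormedSpace ℝ E]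
  [IsScalarTower ℝ 𝕜 E]

theorem generates_iff {f : E →ₗ.[𝕜] E} {T : ℝ → E →L[𝕜] E} :
    Generates f T ↔ IsC0Semigroup T ∧ ∀ x y, (x, y) ∈ f.graph ↔ HasGenValue T x y := by
  have h : ∀ x y, HasGenValue T x y ↔
      Tendsto (fun t : ℝ => ((t⁻¹ : ℝ) : 𝕜) • (T t x - x)) (𝓝[>] 0) (𝓝 y) := fun x y => by
    simp only [HasGenValue, RCLike.real_smul_eq_coe_smul (K := 𝕜)]
  simp only [h]
  exact ⟨fun H => ⟨H.1, H.2⟩, fun H => ⟨H.1, H.2⟩⟩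

theorem Generates.dense_domain [CompleteSpace E] {f : E →ₗ.[𝕜] E} {T : ℝ → E →L[𝕜] E}
    (h : Generates f T) : Dense (f.domain : Set E) := by
  refine (generates_iff.1 h).1.dense_hasGenValue.mono ?_
  rintro x ⟨y, hy⟩
  obtain ⟨z, hz, -⟩ := (LinearPMap.mem_graph_iff f).1 (((generates_iff.1 h).2 x y).2 hy)
  exact (show (z : E) = x from hz) ▸ z.2

end Generates

/-! ### Decoupling the operator matrix by the Dirichlet shear -/

namespace BoundarySetting

variable {𝕜 X dX dY : Type*} [RCLike 𝕜]
  [NormedAddCommGroup X] [NormedSpace 𝕜 X]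
  [NormedAddCommGroup dX] [NormedSpace 𝕜 dX]
  [NormedAddCommGroup dY] [NormedSpace 𝕜 dY]
  (S : BoundarySetting 𝕜 X dX dY)

theorem L_dirichlet {μ : 𝕜} (hμ : μ ∈ S.A₀.resolventSetOp) (y : dY) :
    S.L (S.dirichlet hμ y) = y :=
  (LinearEquiv.ofBijective _ (S.bijective_L_eigenspace hμ)).apply_symm_apply y

theorem A_dirichlet {μ : 𝕜} (hμ : μ ∈ S.A₀.resolventSetOp) (y : dY) :
    S.A (S.dirichlet hμ y) = μ • (S.dirichlet hμ y : X) :=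
  sub_eq_zero.1 ((LinearEquiv.ofBijective _ (S.bijective_L_eigenspace hμ)).symm y).2

theorem CDirichlet_apply {μ : 𝕜} (hμ : μ ∈ S.A₀.resolventSetOp) (y : dY)
    (h : S.ι y ∈ (S.CDirichlet hμ).domain) :
    S.CDirichlet hμ ⟨S.ι y, h⟩ =
      S.C ⟨S.dirichlet hμ y, S.A_domain_le (S.dirichlet hμ y).2⟩ := by
  have : (LinearEquiv.ofInjective S.ι.toLinearMap S.ι_injective).symm ⟨S.ι y, h⟩ = y :=
    (LinearEquiv.symm_apply_eq _).2 rfl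
  change S.C ⟨S.dirichlet hμ ((LinearEquiv.ofInjective S.ι.toLinearMap S.ι_injective).symm
    ⟨S.ι y, h⟩), _⟩ = _
  simp only [this]

theorem mem_feedback_domain {μ : 𝕜} (hμ : μ ∈ S.A₀.resolventSetOp) {x : dX} :
    x ∈ (S.feedback hμ).domain ↔ ∃ y, S.ι y = x ∧ x ∈ S.D.domain :=
  ⟨fun h => ⟨h.2.choose, h.2.choose_spec, h.1⟩, fun ⟨y, hy, hx⟩ => ⟨hx, y, hy⟩⟩

theorem feedback_apply {μ : 𝕜} (hμ : μ ∈ S.A₀.resolventSetOp) (y : dY)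
    (h : S.ι y ∈ (S.feedback hμ).domain) :
    S.feedback hμ ⟨S.ι y, h⟩ = S.D ⟨S.ι y, h.1⟩ +
      S.C ⟨S.dirichlet hμ y, S.A_domain_le (S.dirichlet hμ y).2⟩ := by
  rw [← S.CDirichlet_apply hμ y h.2]
  rfl

theorem mem_graph_feedback_iff {μ : 𝕜} (hμ : μ ∈ S.A₀.resolventSetOp) {x z : dX} :
    (x, z) ∈ (S.feedback hμ).graph ↔ ∃ (y : dY) (h : S.ι y ∈ S.D.domain), S.ι y = x ∧
      S.D ⟨S.ι y, h⟩ + S.C ⟨S.dirichlet hμ y, S.A_domain_le (S.dirichlet hμ y).2⟩ = z := by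
  rw [LinearPMap.mem_graph_iff]
  constructor
  · rintro ⟨⟨x', hx'⟩, hx, hz⟩
    obtain ⟨y, rfl, hD⟩ := (S.mem_feedback_domain hμ).1 hx'
    rw [feedback_apply] at hz
    exact ⟨y, hD, hx, hz⟩
  · rintro ⟨y, h, hx, hz⟩
    exact ⟨⟨S.ι y, h, y, rfl⟩, hx, (S.feedback_apply hμ y ⟨h, y, rfl⟩).trans hz⟩

theorem mem_graph_A₀_sub_iff (Q : dX →L[𝕜] X) {w v : X} :
    (w, v) ∈ (S.A₀ - Q.toLinearMap.compPMap S.C).graph ↔ ∃ a : S.A.domain, S.L a = 0 ∧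
      (a : X) = w ∧ S.A a - Q (S.C ⟨a, S.A_domain_le a.2⟩) = v := by
  rw [LinearPMap.mem_graph_iff]
  constructor
  · rintro ⟨⟨w', ⟨⟨a, ha, rfl⟩, ha'⟩, hC⟩, hw, hv⟩
    exact ⟨a, ha, hw, hv⟩
  · rintro ⟨a, ha, hw, hv⟩
    exact ⟨⟨a, ⟨⟨a, ha, rfl⟩, a.2⟩, S.A_domain_le a.2⟩, hw, hv⟩

theorem mem_graph_matrix_iff {p q : X × dX} :
    (p, q) ∈ S.matrix.graph ↔ ∃ (a : S.A.domain) (h : S.ι (S.L a) ∈ S.D.domain),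
      ((a : X), S.ι (S.L a)) = p ∧
      (S.A a + S.B ⟨S.ι (S.L a), S.D_domain_le h⟩,
        S.C ⟨a, S.A_domain_le a.2⟩ + S.D ⟨S.ι (S.L a), h⟩) = q := by
  rw [LinearPMap.mem_graph_iff]
  constructor
  · rintro ⟨⟨⟨u, x⟩, hu, hx, hL⟩, hp, hq⟩
    dsimp only at hu hx hL
    subst hL
    exact ⟨⟨u, hu⟩, hx, hp, hq⟩
  · rintro ⟨a, h, hp, hq⟩
    exact ⟨⟨(a, S.ι (S.L a)), a.2, h, rfl⟩, hp, hq⟩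

/-- The shear `(u, x) ↦ (u - Q x, x)`. -/
def shear (Q : dX →L[𝕜] X) : (X × dX) ≃L[𝕜] X × dX :=
  ContinuousLinearEquiv.equivOfInverse
    ((ContinuousLinearMap.fst 𝕜 X dX - Q.comp (ContinuousLinearMap.snd 𝕜 X dX)).prod
      (ContinuousLinearMap.snd 𝕜 X dX))
    ((ContinuousLinearMap.fst 𝕜 X dX + Q.comp (ContinuousLinearMap.snd 𝕜 X dX)).prod
      (ContinuousLinearMap.snd 𝕜 X dX))
    (fun p => by simp) (fun p => by simp)

theorem shear_apply (Q : dX →L[𝕜] X) (p : X × dX) : shear Q p = (p.1 - Q p.2, p.2) := rfl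

/-- The shear by the extended Dirichlet operator turns the operator matrix into a bounded
off-diagonal perturbation of the diagonal operator with entries `A₀ - Dbar C` and `D + C D₀`. -/
theorem mem_graph_matrix_iff_shear (h₀ : (0 : 𝕜) ∈ S.A₀.resolventSetOp) (Dbar : dX →L[𝕜] X)
    (hDbar : ∀ y : dY, Dbar (S.ι y) = (S.dirichlet h₀ y : X)) (P : dX →L[𝕜] X)
    (hP : ∀ x : (S.B - Dbar.toLinearMap.compPMap (S.feedback h₀)).domain,
      P x = (S.B - Dbar.toLinearMap.compPMap (S.feedback h₀)) x)
    (C : X →L[𝕜] dX) (hC : ∀ u : S.C.domain, C u = S.C u) (p q : X × dX) :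
    (p, q) ∈ S.matrix.graph ↔
      ((shear Dbar p).1, (shear Dbar q).1 - P (shear Dbar p).2) ∈
          (S.A₀ - Dbar.toLinearMap.compPMap S.C).graph ∧
        ((shear Dbar p).2, (shear Dbar q).2 - C (shear Dbar p).1) ∈ (S.feedback h₀).graph := by
  have hPι : ∀ (y : dY) (h : S.ι y ∈ S.D.domain), P (S.ι y) = S.B ⟨S.ι y, S.D_domain_le h⟩ -
      Dbar (S.D ⟨S.ι y, h⟩ + C (S.dirichlet h₀ y)) := fun y h => by
    rw [hC ⟨S.dirichlet h₀ y, S.A_domain_le (S.dirichlet h₀ y).2⟩,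
      ← S.feedback_apply h₀ y ⟨h, y, rfl⟩]
    exact hP ⟨S.ι y, S.D_domain_le h, h, y, rfl⟩
  have hC' : ∀ a : S.A.domain, S.C ⟨a, S.A_domain_le a.2⟩ = C a := fun a => (hC ⟨a, _⟩).symm
  have hA0 : ∀ y, S.A (S.dirichlet h₀ y) = 0 := fun y => by rw [S.A_dirichlet, zero_smul]
  rw [mem_graph_matrix_iff, mem_graph_A₀_sub_iff, mem_graph_feedback_iff, shear_apply, shear_apply]
  obtain ⟨u, x⟩ := p
  obtain ⟨v, y⟩ := q
  simp only [hC', Prod.mk.injEq]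
  constructor
  · rintro ⟨a, h, ⟨rfl, rfl⟩, rfl, rfl⟩
    -- Subtracting the Dirichlet lift of its boundary value puts `a` into ker L without changing A
    -- a.
    refine ⟨⟨a - S.dirichlet h₀ (S.L a), ?_, ?_, ?_⟩, S.L a, h, rfl, ?_⟩
    · rw [map_sub, L_dirichlet, sub_self]
    · rw [hDbar]; rfl
    · rw [LinearPMap.map_sub, hA0, hPι _ h, Submodule.coe_sub]
      simp only [map_add, map_sub]
      abel
    · rw [hDbar, map_sub]
      abel
  · rintro ⟨⟨a, ha, hau, hav⟩, b, h, rfl, hby⟩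
    -- Conversely, adding the lift of `b` to an element of ker L restores the boundary value `b`.
    have hu : u = a + (S.dirichlet h₀ b : X) := by rw [hau, hDbar]; abel
    have hL : S.L (a + S.dirichlet h₀ b) = b := by rw [map_add, ha, L_dirichlet, zero_add]
    have hy : y = S.D ⟨S.ι b, h⟩ + C (S.dirichlet h₀ b) + C a := by
      rw [hby, hau]; abel
    refine ⟨a + S.dirichlet h₀ b, by rwa [hL], ⟨hu.symm, by rw [hL]⟩, ?_, ?_⟩
    · simp only [hL]
      rw [LinearPMap.map_add, hA0, add_zero]
      have hv : v = S.A a - Dbar (C a) + Dbar y + P (S.ι b) := by rw [hav]; abel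
      rw [hv, hPι b h, hy]
      simp only [map_add]
      abel
    · simp only [hL]
      rw [hy, Submodule.coe_add, map_add]
      abel

/-- On D(D) ∩ dY the operator is (B - Dbar D) - Dbar C Dbar, and C is bounded. -/
theorem isBoundedOp_sub_feedback (h₀ : (0 : 𝕜) ∈ S.A₀.resolventSetOp) (Dbar : dX →L[𝕜] X)
    (hDbar : ∀ y : dY, Dbar (S.ι y) = (S.dirichlet h₀ y : X))
    (hBD : ((S.B - Dbar.toLinearMap.compPMap S.D).domRestrict
      (LinearMap.range S.ι.toLinearMap)).IsBoundedOp) (hC : S.C.IsBoundedOp) :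
    (S.B - Dbar.toLinearMap.compPMap (S.feedback h₀)).IsBoundedOp := by
  obtain ⟨c, hc⟩ := hBD
  refine ⟨c + ‖Dbar‖ * (S.C.opNormOn * ‖Dbar‖), ?_⟩
  rintro ⟨x, hB, hD, y, rfl⟩
  have h1 := hc ⟨S.ι y, ⟨y, rfl⟩, hB, hD⟩
  have h2 := hC.le_opNormOn ⟨S.dirichlet h₀ y, S.A_domain_le (S.dirichlet h₀ y).2⟩
  have e : (S.B - Dbar.toLinearMap.compPMap (S.feedback h₀)) ⟨S.ι y, hB, hD, y, rfl⟩ =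
      (S.B - Dbar.toLinearMap.compPMap S.D).domRestrict (LinearMap.range S.ι.toLinearMap)
        ⟨S.ι y, ⟨y, rfl⟩, hB, hD⟩ -
      Dbar (S.C ⟨S.dirichlet h₀ y, S.A_domain_le (S.dirichlet h₀ y).2⟩) := by
    change S.B ⟨S.ι y, hB⟩ - Dbar (S.feedback h₀ ⟨S.ι y, hD, y, rfl⟩) =
      S.B ⟨S.ι y, hB⟩ - Dbar (S.D ⟨S.ι y, hD⟩) - _
    rw [S.feedback_apply h₀ y ⟨hD, y, rfl⟩, map_add, sub_sub]
  refine (congrArg norm e).trans_le ((norm_sub_le _ _).trans ?_)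
  rw [add_mul]
  refine add_le_add h1 ((Dbar.le_opNorm_of_le h2).trans ?_)
  rw [← hDbar, mul_assoc, mul_assoc]
  have := S.C.opNormOn_nonneg
  gcongr
  exact Dbar.le_opNorm _

end BoundarySetting

/-! ### Generation and exponential stability of the matrix -/

theorem mainTheorem7 {𝕜 X dX dY : Type*} [RCLike 𝕜]
    [NormedAddCommGroup X] [NormedSpace 𝕜 X] [CompleteSpace X]
    [NormedAddCommGroup dX] [NormedSpace 𝕜 dX] [CompleteSpace dX]
    [NormedAddCommGroup dY] [NormedSpace 𝕜 dY] [CompleteSpace dY]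
    (S : BoundarySetting 𝕜 X dX dY)
    -- `A₀` is invertible
    (h₀ : (0 : 𝕜) ∈ S.A₀.resolventSetOp)
    -- `Dbar` is a bounded extension to `dX` of the Dirichlet operator `D₀`
    (Dbar : dX →L[𝕜] X)
    (hDbar : ∀ y : dY, Dbar (S.ι y) = (S.dirichlet h₀ y : X))
    -- `B - Dbar D` is bounded (on `D(D) ∩ dY`)
    (hBD : ((S.B - Dbar.toLinearMap.compPMap S.D).domRestrict
      (LinearMap.range S.ι.toLinearMap)).IsBoundedOp)
    (M₁ M₂ ε₁ ε₂ : ℝ) (hM₁ : 1 ≤ M₁) (hM₂ : 1 ≤ M₂) (hε₁ : ε₁ < 0) (hε₂ : ε₂ < 0)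
    -- `A₀ - Dbar C` and `D + C D₀` generate semigroups with exponential bounds
    (T₁ : ℝ → X →L[𝕜] X) (hT₁ : Generates (S.A₀ - Dbar.toLinearMap.compPMap S.C) T₁)
    (hT₁bound : ∀ t : ℝ, 0 ≤ t → ‖T₁ t‖ ≤ M₁ * Real.exp (ε₁ * t))
    (T₂ : ℝ → dX →L[𝕜] dX) (hT₂ : Generates (S.feedback h₀) T₂)
    (hT₂bound : ∀ t : ℝ, 0 ≤ t → ‖T₂ t‖ ≤ M₂ * Real.exp (ε₂ * t))
    (hC : S.C.IsBoundedOp)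
    (hsmall : S.C.opNormOn *
      (S.B - Dbar.toLinearMap.compPMap (S.feedback h₀)).opNormOn < ε₁ * ε₂ / (M₁ * M₂)) :
    (∃ T : ℝ → X × dX →L[𝕜] X × dX, Generates S.matrix T) ∧
      ∀ T : ℝ → X × dX →L[𝕜] X × dX, Generates S.matrix T →
        UniformlyExponentiallyStable T := by
  let _ : NormedSpace ℝ X := NormedSpace.restrictScalars ℝ 𝕜 X
  let _ : NormedSpace ℝ dX := NormedSpace.restrictScalars ℝ 𝕜 dX
  have _ : IsScalarTower ℝ 𝕜 X := .of_algebraMap_smul fun _ _ => rfl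
  have _ : IsScalarTower ℝ 𝕜 dX := .of_algebraMap_smul fun _ _ => rfl
  -- Generator domains are dense and lie in the domains of C and of B - Dbar (D + C D₀), so both
  -- operators extend without increase of norm.
  obtain ⟨C, hCn, hCe⟩ := hC.exists_extension (hT₁.dense_domain.mono fun _ h => h.2)
  obtain ⟨P, hPn, hPe⟩ := (S.isBoundedOp_sub_feedback h₀ Dbar hDbar hBD hC).exists_extension
    (hT₂.dense_domain.mono fun _ h => ⟨S.D_domain_le h.1, h⟩)
  obtain ⟨hT₁', hg₁⟩ := generates_iff.1 hT₁
  obtain ⟨hT₂', hg₂⟩ := generates_iff.1 hT₂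
  have hgain : (M₂ * ‖C‖) * (M₁ * ‖P‖) < -ε₁ * -ε₂ := by
    have := (mul_le_mul hCn hPn (norm_nonneg _) S.C.opNormOn_nonneg).trans_lt hsmall
    rw [lt_div_iff₀ (by positivity)] at this
    linarith
  obtain ⟨V, hV, hVs, hgen⟩ := exists_stable_offDiagonal hT₁' hT₂' (neg_pos.2 hε₁)
    (by simpa only [neg_neg] using hT₁bound) (by simpa only [neg_neg] using hT₂bound) P C hgain
  have hW := hV.conj (BoundarySetting.shear Dbar)
  have hWs := hVs.conj (BoundarySetting.shear Dbar)
  have hWgen := generates_iff.2 ⟨hW, fun p q => by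
    rw [hasGenValue_conj_iff, hgen, ← hg₁, ← hg₂,
      S.mem_graph_matrix_iff_shear h₀ Dbar hDbar P hPe C hCe]⟩
  refine ⟨⟨_, hWgen⟩, fun T hT => ?_⟩
  obtain ⟨N, ω, hω, hN⟩ := hWs
  refine ⟨N, ω, hω, fun t ht => ?_⟩
  obtain ⟨hT', hg⟩ := generates_iff.1 hT
  -- Any semigroup generated by the matrix agrees with the constructed one for t ≥ 0 and inherits
  -- its bound.
  rw [← hW.eq_of_hasGenValue_iff (norm_le_of_le_mul_exp_neg hω hN) hT'
    (fun p q => ((generates_iff.1 hWgen).2 p q).symm.trans (hg p q)) ht]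
  exact hN t ht
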